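/- **Theorem 4.3.** Let $R$ be a commutative Noetherian ring and let $D(R)$ be the derived category of $R$-modules, with homological indexing and suspension $s$, so that $H_n(sM)=H_{n-1}(M)$. Let $\mathcal D\subset D(R)$ be one of the following two full triangulated subcategories: - $D_{\mathrm{qc}}(R)$, the objects $M$ such that every $H_n(M)$ is finitely generated and $H_n(M)=0$ for all but finitely many $n$; - $D_{\mathrm{parf}}(R)$, the objects isomorphic in $D(R)$ to bounded complexes of finitely generated projective modules. An *aisle* in $\mathcal D$ is a full subcategory $\mathcal U\subset\mathcal D$ such that $sX\in\mathcal U$ for all $X\in\mathcal U$, such that for every distinguished triangle $X\to Y\to Z\to sX$ in $\mathcal D$ with $X,Z\in\mathcal U$ one has $Y\in\mathcal U$, and such that the inclusion $\mathcal U\to\mathcal D$ has a right adjoint. For an aisle $\mathcal A$ in $\mathcal D$ and $n\in\mathbb Z$ put $$\phi(\mathcal A)(n)=\{p\in\operatorname{Spec}R \mid \text{there are } M\in\mathcal A \text{ and } q\in\operatorname{Ass}H_n(M) \text{ with } q\subset p\}.$$ Let $\mathcal S$ be the set of functions $f$ from $\mathbb Z$ to the subsets of $\operatorname{Spec}R$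 closed under specialization with $f(n)\subset f(n+1)$ for all $n$. Let $\mathcal A,\mathcal A'$ be aisles in $\mathcal D$. Then $\mathcal A\subset\mathcal A'$ if and only if $\phi(\mathcal A)(n)\subset\phi(\mathcal A')(n)$ for every $n\in\mathbb Z$. Moreover $\phi(\mathcal A)\in\mathcal S$ for every aisle $\mathcal A$ in $\mathcal D$, and hence $\phi\colon\{\text{aisles in }\mathcal D\}\to\mathcal S$ is injective. -/

import Mathlib

open CategoryTheory

universe w v u

noncomputable section

namespace Aisles

section General

open Pretriangulated

variable {T : Type u} [Category.{v} T] [Preadditive T] [Limits.HasZeroObject T] [HasShift T ℤ]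
  [∀ n : ℤ, (shiftFunctor T n).Additive] [Pretriangulated T]

/-- Let `D` be (the class of objects of) a full triangulated subcategory of a triangulated
category `T`. A full subcategory `U` of `D` is a pre-aisle in `D` if it is closed under suspension
and under extensions. The distinguished triangles of `D` are those of `T` with vertices in `D`.
(For `D = ⊤` these are the pre-aisles in `T`.) -/
structure IsPreaisle (D U : ObjectProperty T) : Prop where
  le : U ≤ D
  suspension : ∀ X : T, U X → U (X⟦(1 : ℤ)⟧)
  extension : ∀ t : Triangle T, t ∈ distTriang T → D t.obj₂ → U t.obj₁ → U t.obj₃ → U t.obj₂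

/-- An aisle in `D`: a pre-aisle `U` in `D` such that the inclusion functor `U ⥤ D` of full
subcategories has a right adjoint. -/
structure IsAisle (D U : ObjectProperty T) : Prop extends IsPreaisle D U where
  hasRightAdjoint : (ObjectProperty.ιOfLE le).IsLeftAdjoint

end General

section Ring

variable (R : Type u) [CommRing R]

/-- The closure of a set of primes under specialization. -/
def specClosure {R : Type u} [CommRing R] (U : Set (PrimeSpectrum R)) : Set (PrimeSpectrum R) :=
  {p | ∃ q ∈ U, q.asIdeal ≤ p.asIdeal}

/-- `Ass M`, as a subset of `Spec R`. -/
def ass (M : Type u) [AddCommGroup M] [Module R M] : Set (PrimeSpectrum R) :=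
  {p | p.asIdeal ∈ associatedPrimes R M}

/-- The increasing functions from `ℤ` to the subsets of `Spec R` closed under specialization. -/
def increasingFunctions : Set (ℤ → Set (PrimeSpectrum R)) :=
  {f | (∀ n, f n = specClosure (f n)) ∧ ∀ n, f n ⊆ f (n + 1)}

variable [HasDerivedCategory.{w} (ModuleCat.{u} R)]

/-- The homology `H_n(M)` with homological indexing (differentials of degree `-1`):
Mathlib's derived category is cohomologically indexed, so `H_n = H^{-n}`.
Then `H_n(M⟦1⟧) = H_{n-1}(M)`. -/
abbrev homology {R : Type u} [CommRing R] [HasDerivedCategory.{w} (ModuleCat.{u} R)]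
    (M : DerivedCategory (ModuleCat.{u} R)) (n : ℤ) : ModuleCat.{u} R :=
  (DerivedCategory.homologyFunctor (ModuleCat.{u} R) (-n)).obj M

/-- `D_qc(R)`: the objects of `D(R)` all of whose homology modules are finitely generated
and whose homology is bounded above and below. -/
def Dqc : ObjectProperty (DerivedCategory (ModuleCat.{u} R)) := fun M ↦
  (∀ n : ℤ, Module.Finite R (homology M n)) ∧
    ∃ a b : ℤ, ∀ n : ℤ, n < a ∨ b < n → Subsingleton (homology M n)

/-- `D_parf(R)`: the perfect complexes, i.e. the objects of `D(R)` represented by bounded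
complexes of finitely generated projective modules. -/
def Dparf : ObjectProperty (DerivedCategory (ModuleCat.{u} R)) := fun M ↦
  ∃ K : CochainComplex (ModuleCat.{u} R) ℤ,
    (∀ i : ℤ, Module.Finite R (K.X i) ∧ Module.Projective R (K.X i)) ∧
    (∃ a b : ℤ, ∀ i : ℤ, i < a ∨ b < i → Subsingleton (K.X i)) ∧
    Nonempty (DerivedCategory.Q.obj K ≅ M)

/-- `φ(A)(n)`: the primes in the specialization closure of `Ass H_n(M)` for some `M ∈ A`. -/
def phi {R : Type u} [CommRing R] [HasDerivedCategory.{w} (ModuleCat.{u} R)]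
    (A : ObjectProperty (DerivedCategory (ModuleCat.{u} R))) (n : ℤ) : Set (PrimeSpectrum R) :=
  {p | ∃ M : DerivedCategory (ModuleCat.{u} R), A M ∧ p ∈ specClosure (ass R (homology M n))}

end Ring

end Aisles

end

/-!
Let `𝒟` be `D_qc(R)` or `D_parf(R)`. Both are triangulated subcategories of `D(R)` contained in
`D_qc(R)`, and nothing else about them is used. By Noetherianity `φ(A)(n)` is the union of the
supports of `H_n(M)`, `M ∈ A`, so everything follows from this assertion: if `A'` is an aisle in
`𝒟` and `X ∈ 𝒟` satisfies `Supp H_n(X) ⊆ φ(A')(n)` for all `n`, then `X ∈ A'`.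

An aisle is the left orthogonal in `𝒟` of its right orthogonal (`IsAisle.mem_of_forall_eq_zero`),
so it has to be shown that `Hom(X, Y) = 0` for every `Y ∈ 𝒟` right orthogonal to `A'`. The class of
objects without nonzero morphisms to `Y` is closed under extensions. By dévissage
(`of_single_homology`, `single_of_single_quotient`) it suffices to see that
`Hom((R ⧸ p)[-i], Y) = 0` for `p ∈ φ(A')(n)` and `i ≤ -n`; this is `IsPreaisle.eq_zero_of_mem_phi`.

The proof of this vanishing is by induction on `i`, starting below the cohomology of the bounded
object `Y`, and for given `i` by Noetherian induction on `p`, starting from the maximal ideals.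
Iterated cones of multiplications by generators of `p`, and a shift, produce an object `M ∈ A'`
supported on the closure of `p` whose top cohomology module at `p` sits in degree `i`
(`IsPreaisle.exists_of_mem_phi`). Now `Hom(M, Y) = 0`. Up to objects which vanish at `p` and objects
without nonzero morphisms to `Y` by the induction hypothesis, `M` is `H^i(M)[-i]`
(`homTorsion_single_homology`), and this is built from `(R ⧸ p)[-i]` in the same sense
(`homTorsion_single_quotient`). Hence `Hom((R ⧸ p)[-i], Y)_p = 0`. But multiplication by an element
outside `p` is injective on this group because its cone is controlled by the primes strictly
containing `p` (`eq_zero_of_homTorsion_single_quotient`), so the group itself vanishes. Localization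
at `p` is expressed by `homTorsion`: morphisms to `Y` that are annihilated by some element
outside `p`.
-/

noncomputable section

namespace Aisles

/-! ### Aisles and orthogonality -/

section Aisle

open Pretriangulated Limits

variable {T : Type u} [Category.{v} T] [Preadditive T] [HasZeroObject T] [HasShift T ℤ]
  [∀ n : ℤ, (shiftFunctor T n).Additive] [Pretriangulated T] {D U : ObjectProperty T}

open ZeroObject in
lemma IsPreaisle.zero_mem [D.IsTriangulated] [D.IsClosedUnderIsomorphisms] (hU : IsPreaisle D U)
    {X : T} (hX : U X) : U (0 : T) :=
  hU.extension _ (rot_of_distTriang _ (contractible_distinguished X))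
    (D.prop_of_isZero (isZero_zero T)) hX (hU.suspension _ hX)

lemma IsPreaisle.of_iso [D.IsTriangulated] [D.IsClosedUnderIsomorphisms] (hU : IsPreaisle D U)
    {X Y : T} (e : X ≅ Y) (hX : U X) : U Y :=
  hU.extension _ (isomorphic_distinguished _ (contractible_distinguished X) (Triangle.mk e.hom 0 0)
      (Triangle.isoMk _ _ (Iso.refl _) e.symm (Iso.refl _)
        (e.hom_inv_id.trans (Category.id_comp _).symm)
        (zero_comp.trans comp_zero.symm) (zero_comp.trans comp_zero.symm)))
    (D.prop_of_iso e (hU.le _ hX)) hX (hU.zero_mem hX)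

lemma IsPreaisle.shift_nat [D.IsTriangulated] [D.IsClosedUnderIsomorphisms]
    (hU : IsPreaisle D U) (n : ℕ) {X : T} (hX : U X) : U (X⟦(n : ℤ)⟧) := by
  induction n with
  | zero => exact hU.of_iso ((shiftFunctorZero' T _ Nat.cast_zero).symm.app X) hX
  | succ n ih =>
    exact hU.of_iso ((shiftFunctorAdd' T (n : ℤ) 1 _ (Nat.cast_succ n).symm).symm.app X)
      (hU.suspension _ ih)

/-- The cone of the counit `A ⟶ X` is right orthogonal to the aisle `U`. A map `B ⟶ Y` from an
object of `U` to this cone gives an extension `E` of `B` by `A` with a map `E ⟶ X`; the latter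
factors through `A`, so that the extension splits. -/
lemma IsPreaisle.eq_zero_of_distTriang [D.IsTriangulated] [D.IsClosedUnderIsomorphisms]
    (hU : IsPreaisle D U) {A X Y : T} (e : A ⟶ X) (g : X ⟶ Y) (h : Y ⟶ A⟦(1 : ℤ)⟧)
    (hT : Triangle.mk e g h ∈ distTriang T) (hA : U A)
    (he : ∀ B, U B → Function.Bijective fun f : B ⟶ A ↦ f ≫ e)
    {B : T} (hB : U B) (f : B ⟶ Y) : f = 0 := by
  -- The extension of `B` by `A` classified by `B ⟶ Y ⟶ A⟦1⟧`.
  obtain ⟨E, i, π, hE⟩ := distinguished_cocone_triangle₂ (f ≫ h)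
  have hUE : U E := hU.extension _ hE
    (D.ext_of_isTriangulatedClosed₂ _ hE (hU.le _ hA) (hU.le _ hB)) hA hB
  obtain ⟨b, hb₁, -⟩ := complete_distinguished_triangle_morphism₂ _ _ hE hT (𝟙 A) f
    (show (f ≫ h) ≫ (𝟙 A)⟦(1 : ℤ)⟧' = f ≫ h by simp)
  obtain ⟨b', rfl⟩ := (he E hUE).2 b
  have hi : i ≫ b' = 𝟙 A := (he A hA).1 ((Category.assoc _ _ _).trans hb₁)
  have hfh : f ≫ h = 0 := by
    have h₁ : (f ≫ h) ≫ i⟦(1 : ℤ)⟧' = 0 := comp_distTriang_mor_zero₃₁ _ hE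
    have h₂ : i⟦(1 : ℤ)⟧' ≫ b'⟦(1 : ℤ)⟧' = 𝟙 _ := by rw [← Functor.map_comp, hi,
      CategoryTheory.Functor.map_id]
    rw [← Category.comp_id (f ≫ h), ← h₂, ← Category.assoc, h₁, zero_comp]
  obtain ⟨f', rfl⟩ := Triangle.coyoneda_exact₃ _ hT f hfh
  obtain ⟨f'', rfl⟩ := (he B hB).2 f'
  have : e ≫ g = 0 := comp_distTriang_mor_zero₁₂ _ hT
  exact (Category.assoc f'' e g).trans (by rw [this, comp_zero])

/-- An aisle in `D` is the left orthogonal in `D` of its right orthogonal in `D`. -/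
lemma IsAisle.mem_of_forall_eq_zero [D.IsTriangulated] [D.IsClosedUnderIsomorphisms]
    (hU : IsAisle D U) {X : T} (hX : D X)
    (h : ∀ Y, D Y → (∀ B, U B → ∀ f : B ⟶ Y, f = 0) → ∀ f : X ⟶ Y, f = 0) : U X := by
  have := hU.hasRightAdjoint
  let F := ObjectProperty.ιOfLE hU.le
  let adj := Adjunction.ofIsLeftAdjoint F
  let A := (F.rightAdjoint).obj ⟨X, hX⟩
  let e : A.obj ⟶ X := (adj.counit.app ⟨X, hX⟩).hom
  have he : ∀ B, U B → Function.Bijective fun f : B ⟶ A.obj ↦ f ≫ e := by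
    intro B hB
    have h₁ := ((adj.homEquiv ⟨B, hB⟩ ⟨X, hX⟩).symm).bijective
    constructor
    · intro f f' hf
      have : ObjectProperty.homMk f =
          (ObjectProperty.homMk f' : (⟨B, hB⟩ : U.FullSubcategory) ⟶ A) := by
        apply h₁.1
        rw [Adjunction.homEquiv_counit, Adjunction.homEquiv_counit]
        exact ObjectProperty.hom_ext _ hf
      exact congrArg (fun k ↦ k.hom) this
    · intro g
      obtain ⟨f, hf⟩ := h₁.2 (ObjectProperty.homMk g)
      rw [Adjunction.homEquiv_counit] at hf
      exact ⟨f.hom, congrArg (fun k ↦ k.hom) hf⟩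
  obtain ⟨Y, g, k, hT⟩ := distinguished_cocone_triangle e
  have hY : D Y := D.ext_of_isTriangulatedClosed₃ _ hT (hU.le _ A.property) hX
  have hg : g = 0 := h Y hY (fun B hB f ↦
    IsPreaisle.eq_zero_of_distTriang hU.toIsPreaisle e g k hT A.property he hB f) g
  -- The identity of `X` factors through the counit, which is therefore an isomorphism.
  obtain ⟨s, hs⟩ : ∃ s : X ⟶ A.obj, 𝟙 X = s ≫ e :=
    Triangle.coyoneda_exact₂ _ hT (𝟙 X) ((Category.id_comp g).trans hg)
  have hes : e ≫ s = 𝟙 _ := (he _ A.property).1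
    (show (e ≫ s) ≫ e = 𝟙 _ ≫ e by rw [Category.assoc, ← hs, Category.comp_id, Category.id_comp])
  exact hU.of_iso ⟨e, s, hes, hs.symm⟩ A.property

end Aisle

/-! ### Morphisms annihilated by a multiplicative set -/

section Torsion

open Pretriangulated Limits

variable {R : Type*} [CommRing R] {T : Type u} [Category.{v} T] [Preadditive T] [Linear R T]

/-- The objects `W` such that every morphism `W ⟶ Y` is annihilated by some element of the
multiplicative set `S`. For `S = ⊥` these are the objects with no nonzero morphism to `Y`; for
the complement of a prime `p` they are the objects with `Hom(W, Y)_p = 0`. -/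
def homTorsion (S : Submonoid R) (Y : T) : ObjectProperty T :=
  fun W ↦ ∀ f : W ⟶ Y, ∃ r ∈ S, r • f = 0

lemma homTorsion_bot_iff (Y W : T) :
    homTorsion (⊥ : Submonoid R) Y W ↔ ∀ f : W ⟶ Y, f = 0 := by
  simp [homTorsion, Submonoid.mem_bot]

lemma homTorsion_mono {S S' : Submonoid R} (h : S ≤ S') (Y : T) :
    homTorsion S Y ≤ homTorsion S' Y := fun _ hW f ↦
  let ⟨r, hr, hf⟩ := hW f
  ⟨r, h hr, hf⟩

lemma homTorsion_of_smul_id {S : Submonoid R} {W : T} (Y : T) {r : R} (hr : r ∈ S)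
    (h : r • 𝟙 W = 0) : homTorsion S Y W := fun f ↦
  ⟨r, hr, by rw [← Category.id_comp f, ← Linear.smul_comp, h, zero_comp]⟩

instance (S : Submonoid R) (Y : T) : (homTorsion S Y).IsClosedUnderIsomorphisms where
  of_iso e hX f := by
    obtain ⟨r, hr, h⟩ := hX (e.hom ≫ f)
    refine ⟨r, hr, ?_⟩
    rw [← cancel_epi e.hom, Linear.comp_smul, h, comp_zero]

variable [HasZeroObject T] [HasShift T ℤ] [∀ n : ℤ, (shiftFunctor T n).Additive] [Pretriangulated T]

instance (S : Submonoid R) (Y : T) : (homTorsion S Y).IsTriangulatedClosed₂ :=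
  .mk' fun Δ hΔ h₁ h₃ f ↦ by
    obtain ⟨r, hr, h⟩ := h₁ (Δ.mor₁ ≫ f)
    obtain ⟨g, hg⟩ := Triangle.yoneda_exact₂ _ hΔ (r • f) (by rw [Linear.comp_smul, h])
    obtain ⟨s, hs, h'⟩ := h₃ g
    exact ⟨s * r, mul_mem hs hr, by rw [mul_smul, hg, ← Linear.comp_smul, h', comp_zero]⟩

instance (S : Submonoid R) (Y : T) : (homTorsion S Y).ContainsZero where
  exists_zero := ⟨_, isZero_zero T, fun _ ↦ ⟨1, one_mem S, (isZero_zero T).eq_of_src _ _⟩⟩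

end Torsion

/-! ### Homology in the derived category -/

section Linear

open DerivedCategory

variable {R : Type*} [Ring R] {C : Type u} [Category.{v} C] [Abelian C] [Linear R C]
  [HasDerivedCategory.{w} C]

lemma homologyFunctor_map_smul_id (X : DerivedCategory C) (x : R) (n : ℤ) :
    (homologyFunctor C n).map (x • 𝟙 X) = x • 𝟙 _ := by
  let K := Q.objPreimage X
  let e : Q.obj K ≅ X := Q.objObjPreimageIso X
  have h₁ : (homologyFunctor C n).map (x • 𝟙 (Q.obj K)) = x • 𝟙 _ := by
    rw [← Q.map_id K, ← Functor.map_smul Q x (𝟙 K),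
      ← cancel_mono ((homologyFunctorFactors C n).hom.app K),
      homologyFunctorFactors_hom_naturality]
    have : HomologicalComplex.homologyMap (x • 𝟙 K) n = x • 𝟙 _ := by
      rw [← HomologicalComplex.homologyMap_id]
      exact ShortComplex.homologyMap_smul (𝟙 (K.sc n)) x
    rw [this, Linear.smul_comp, Category.id_comp]
    exact (Linear.comp_smul _ _ _ _ _ _).trans (congrArg (x • ·) (Category.comp_id _))
  have h₂ : x • 𝟙 X = e.inv ≫ (x • 𝟙 (Q.obj K)) ≫ e.hom := by simp
  rw [h₂, Functor.map_comp, Functor.map_comp, h₁]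
  simp [← Functor.map_comp]

end Linear

section Modules

variable {R : Type u} [CommRing R]

lemma subsingleton_congr {M N : ModuleCat.{u} R} (e : M ≅ N) (h : Subsingleton M) :
    Subsingleton N :=
  ModuleCat.subsingleton_of_isZero ((ModuleCat.isZero_of_subsingleton M).of_iso e.symm)

lemma finite_congr {M N : ModuleCat.{u} R} (e : M ≅ N) (h : Module.Finite R M) :
    Module.Finite R N :=
  Module.Finite.equiv e.toLinearEquiv

lemma finite_of_exact [IsNoetherianRing R] {M N P : Type*} [AddCommGroup M] [AddCommGroup N]
    [AddCommGroup P] [Module R M] [Module R N] [Module R P] [Module.Finite R M]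
    [Module.Finite R P] {f : M →ₗ[R] N} {g : N →ₗ[R] P} (h : Function.Exact f g) :
    Module.Finite R N :=
  have : IsNoetherian R N := isNoetherian_of_range_eq_ker f g h.linearMap_ker_eq.symm
  inferInstance

lemma subsingleton_of_exact {M N P : Type*} [AddCommGroup M] [AddCommGroup N]
    [AddCommGroup P] [Module R M] [Module R N] [Module R P] [Subsingleton M]
    [Subsingleton P] {f : M →ₗ[R] N} {g : N →ₗ[R] P} (h : Function.Exact f g) :
    Subsingleton N := by
  refine subsingleton_of_forall_eq 0 fun x ↦ ?_
  obtain ⟨y, rfl⟩ := (h x).1 (Subsingleton.elim _ _)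
  rw [Subsingleton.elim y 0, map_zero]

end Modules

section Complexes

open Pretriangulated Limits DerivedCategory ZeroObject

variable {R : Type u} [CommRing R] [HasDerivedCategory.{w} (ModuleCat.{u} R)]

/-- `H^a(X[n]) ≅ H^b(X)` for `b = n + a`. -/
def homologyShiftIso (X : DerivedCategory (ModuleCat.{u} R)) (n a b : ℤ) (h : n + a = b) :
    (homologyFunctor (ModuleCat.{u} R) a).obj (X⟦n⟧) ≅
      (homologyFunctor (ModuleCat.{u} R) b).obj X :=
  ((homologyFunctor (ModuleCat.{u} R) 0).shiftIso n a b h).app X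

lemma exact_homology {Δ : Triangle (DerivedCategory (ModuleCat.{u} R))} (hΔ : Δ ∈ distTriang _)
    (n : ℤ) : Function.Exact ((homologyFunctor (ModuleCat.{u} R) n).map Δ.mor₁).hom
      ((homologyFunctor (ModuleCat.{u} R) n).map Δ.mor₂).hom :=
  (ShortComplex.ShortExact.moduleCat_exact_iff_function_exact _).1
    (HomologySequence.exact₂ Δ hΔ n)

lemma exact_homology_δ {Δ : Triangle (DerivedCategory (ModuleCat.{u} R))}
    (hΔ : Δ ∈ distTriang _) (n m : ℤ) (h : n + 1 = m) :
    Function.Exact ((homologyFunctor (ModuleCat.{u} R) n).map Δ.mor₂).hom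
      (HomologySequence.δ Δ n m h).hom :=
  (ShortComplex.ShortExact.moduleCat_exact_iff_function_exact _).1
    (HomologySequence.exact₃ Δ hΔ n m h)

lemma exact_δ_homology {Δ : Triangle (DerivedCategory (ModuleCat.{u} R))}
    (hΔ : Δ ∈ distTriang _) (n m : ℤ) (h : n + 1 = m) :
    Function.Exact (HomologySequence.δ Δ n m h).hom
      ((homologyFunctor (ModuleCat.{u} R) m).map Δ.mor₁).hom :=
  (ShortComplex.ShortExact.moduleCat_exact_iff_function_exact _).1
    (HomologySequence.exact₁ Δ hΔ n m h)

/-! ### The two triangulated subcategories -/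

instance : (Dqc R).IsClosedUnderIsomorphisms where
  of_iso e := by
    rintro ⟨h, a, b, hab⟩
    exact ⟨fun n ↦ finite_congr ((homologyFunctor _ (-n)).mapIso e) (h n), a, b,
      fun n hn ↦ subsingleton_congr ((homologyFunctor _ (-n)).mapIso e) (hab n hn)⟩

instance [IsNoetherianRing R] : (Dqc R).IsTriangulated where
  exists_zero := by
    have h (n : ℤ) : Subsingleton (homology (R := R) (0 : DerivedCategory (ModuleCat.{u} R)) n) :=
      ModuleCat.subsingleton_of_isZero (Functor.map_isZero _ (isZero_zero _))
    exact ⟨0, isZero_zero _, fun n ↦ inferInstance, 0, 0, fun n _ ↦ h n⟩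
  isStableUnderShiftBy m :=
    { le_shift := by
        rintro X ⟨h, a, b, hab⟩
        have e (n : ℤ) : homology X (n - m) ≅ homology (X⟦m⟧) n :=
          (homologyShiftIso X m (-n) (-(n - m)) (by ring)).symm
        exact ⟨fun n ↦ finite_congr (e n) (h _), a + m, b + m,
          fun n hn ↦ subsingleton_congr (e n) (hab _ (by lia))⟩ }
  toIsTriangulatedClosed₂ := .mk' (by
    rintro Δ hΔ ⟨h, a, b, hab⟩ ⟨h', a', b', hab'⟩
    refine ⟨fun n ↦ ?_, min a a', max b b', fun n hn ↦ ?_⟩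
    · have := h n
      have := h' n
      exact finite_of_exact (exact_homology hΔ (-n))
    · have := hab n (by lia)
      have := hab' n (by lia)
      exact subsingleton_of_exact (exact_homology hΔ (-n)))

instance : (Dparf R).IsClosedUnderIsomorphisms where
  of_iso e := fun ⟨K, h, h', ⟨e'⟩⟩ ↦ ⟨K, h, h', ⟨e' ≪≫ e⟩⟩

open CochainComplex in
/-- Perfect complexes are closed under cones: a morphism in the derived category between bounded
complexes of projectives is represented by a morphism of complexes. -/
lemma Dparf_of_distTriang {Δ : Triangle (DerivedCategory (ModuleCat.{u} R))}
    (hΔ : Δ ∈ distTriang _) (h₁ : Dparf R Δ.obj₁) (h₂ : Dparf R Δ.obj₂) : Dparf R Δ.obj₃ := by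
  obtain ⟨K, hK, ⟨a, b, hab⟩, ⟨e⟩⟩ := h₁
  obtain ⟨L, hL, ⟨a', b', hab'⟩, ⟨e'⟩⟩ := h₂
  have : K.IsStrictlyLE b := by
    rw [isStrictlyLE_iff]
    intro i hi
    have := hab i (Or.inr hi)
    exact ModuleCat.isZero_of_subsingleton _
  have (i : ℤ) : Projective (K.X i) := by
    rw [← IsProjective.iff_projective]
    exact (hK i).2
  have := isKProjective_of_projective K b
  obtain ⟨g, hg⟩ : ∃ g : K ⟶ L, e.hom ≫ Δ.mor₁ = Q.map g ≫ e'.hom := by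
    obtain ⟨g, hg⟩ := (IsKProjective.Qh_map_bijective K _).2
      ((quotientCompQhIso _).hom.app K ≫ (e.hom ≫ Δ.mor₁ ≫ e'.inv) ≫
        (quotientCompQhIso _).inv.app L)
    obtain ⟨g, rfl⟩ := (HomotopyCategory.quotient _ _).map_surjective g
    refine ⟨g, ?_⟩
    have h₁ : (quotientCompQhIso _).hom.app K ≫ Q.map g =
        (quotientCompQhIso _).hom.app K ≫ e.hom ≫ Δ.mor₁ ≫ e'.inv := by
      refine ((quotientCompQhIso _).hom.naturality g).symm.trans ?_
      rw [Functor.comp_map, hg]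
      simp
    rw [(cancel_epi _).1 h₁]
    simp
  let e'' : Q.obj (mappingCone g) ≅ Δ.obj₃ := Triangle.π₃.mapIso
    (isoTriangleOfIso₁₂ _ _ (mappingCone_triangle_distinguished g) hΔ e e' hg.symm)
  let e₀ (i : ℤ) : (mappingCone g).X i ≅ ModuleCat.of R (K.X (i + 1) × L.X i) :=
    HomologicalComplex.homotopyCofiber.XIsoBiprod g i (i + 1) rfl ≪≫
      ModuleCat.biprodIsoProd _ _
  refine ⟨mappingCone g, fun i ↦ ?_, ⟨min a' (a - 1), max b' (b - 1), fun i hi ↦ ?_⟩, ⟨e''⟩⟩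
  · have := (hK (i + 1)).1
    have := (hK (i + 1)).2
    have := (hL i).1
    have := (hL i).2
    exact ⟨Module.Finite.equiv (e₀ i).symm.toLinearEquiv,
      Module.Projective.of_equiv (e₀ i).symm.toLinearEquiv⟩
  · have := hab (i + 1) (by lia)
    have := hab' i (by lia)
    exact (e₀ i).toLinearEquiv.injective.subsingleton

instance : (Dparf R).IsTriangulated :=
  have : (Dparf R).ContainsZero := ⟨0, isZero_zero _, 0, fun i ↦ by
    have : Subsingleton ((0 : CochainComplex (ModuleCat.{u} R) ℤ).X i) :=
      ModuleCat.subsingleton_of_isZero ((HomologicalComplex.eval _ _ i).map_isZero (isZero_zero _))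
    exact ⟨inferInstance, inferInstance⟩, ⟨0, 0, fun i _ ↦
      ModuleCat.subsingleton_of_isZero ((HomologicalComplex.eval _ _ i).map_isZero
        (isZero_zero _))⟩, ⟨Q.mapZeroObject⟩⟩
  have : (Dparf R).IsTriangulatedClosed₃ := .mk' fun _ hΔ ↦ Dparf_of_distTriang hΔ
  have : (Dparf R).IsStableUnderShift ℤ := ⟨fun m ↦ ⟨by
    rintro X ⟨K, hK, ⟨a, b, hab⟩, ⟨e⟩⟩
    exact ⟨K⟦m⟧, fun i ↦ hK (i + m), ⟨a - m, b - m, fun i hi ↦ hab (i + m) (by lia)⟩,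
      ⟨(Q.commShiftIso m).app K ≪≫ (shiftFunctor _ m).mapIso e⟩⟩⟩⟩
  have := ObjectProperty.IsTriangulatedClosed₂.of_isTriangulatedClosed₃ (P := Dparf R)
  { }

lemma Dparf_le_Dqc [IsNoetherianRing R] : Dparf R ≤ Dqc R := by
  rintro X ⟨K, hK, ⟨a, b, hab⟩, ⟨e⟩⟩
  have e' (n : ℤ) : K.homology (-n) ≅ homology X n :=
    (homologyFunctorFactors _ (-n)).symm.app K ≪≫ (homologyFunctor _ (-n)).mapIso e
  refine ⟨fun n ↦ finite_congr (e' n) ?_, -b, -a, fun n hn ↦ subsingleton_congr (e' n) ?_⟩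
  · have := (hK (-n)).1
    have := Module.Finite.of_injective (K.iCycles (-n)).hom
      ((ModuleCat.mono_iff_injective _).1 inferInstance)
    exact Module.Finite.of_surjective (K.homologyπ (-n)).hom
      ((ModuleCat.epi_iff_surjective _).1 inferInstance)
  · have := hab (-n) (by lia)
    have : Subsingleton (K.cycles (-n)) :=
      ((ModuleCat.mono_iff_injective (K.iCycles (-n))).1 inferInstance).subsingleton
    exact ((ModuleCat.epi_iff_surjective (K.homologyπ (-n))).1 inferInstance).subsingleton

end Complexes

/-! ### Supports of modules -/

section Support

variable {R : Type u} [CommRing R]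

/-- The specialization closure of the associated primes is the support. -/
lemma specClosure_ass [IsNoetherianRing R] (M : Type u) [AddCommGroup M] [Module R M]
    [Module.Finite R M] : specClosure (ass R M) = Module.support R M := by
  ext p
  constructor
  · rintro ⟨q, hq, hqp⟩
    exact Module.mem_support_iff_of_finite.2
      ((Submodule.annihilator_top (R := R) (M := M)).ge.trans
        ((IsAssociatedPrime.annihilator_le hq).trans hqp))
  · intro hp
    obtain ⟨q, hq, hqp⟩ := Ideal.exists_minimalPrimes_le (Module.annihilator_le_of_mem_support hp)
    exact ⟨⟨q, hq.1.1⟩,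
      Module.associatedPrimes.minimalPrimes_annihilator_subset_associatedPrimes R M hq, hqp⟩

lemma exists_smul_eq_zero_of_notMem_support {M : Type*} [AddCommGroup M] [Module R M]
    [Module.Finite R M] {p : PrimeSpectrum R} (hp : p ∉ Module.support R M) :
    ∃ r ∉ p.asIdeal, ∀ m : M, r • m = 0 := by
  rw [Module.mem_support_iff_of_finite, SetLike.not_le_iff_exists] at hp
  obtain ⟨r, hr, hrp⟩ := hp
  exact ⟨r, hrp, fun m ↦ Module.mem_annihilator.1 hr m⟩

lemma support_subset_union_of_exact {M N P : Type*} [AddCommGroup M] [AddCommGroup N]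
    [AddCommGroup P] [Module R M] [Module R N] [Module R P] {f : M →ₗ[R] N} {g : N →ₗ[R] P}
    (h : Function.Exact f g) :
    Module.support R N ⊆ Module.support R M ∪ Module.support R P := by
  intro p hp
  by_contra hn
  rw [Set.mem_union, not_or, Module.notMem_support_iff', Module.notMem_support_iff'] at hn
  refine (Module.notMem_support_iff'.2 fun n ↦ ?_) hp
  obtain ⟨r, hr, hrn⟩ := hn.2 (g n)
  rw [← map_smul] at hrn
  obtain ⟨m, hm⟩ := (h _).1 hrn
  obtain ⟨s, hs, hsm⟩ := hn.1 m
  exact ⟨s * r, fun h ↦ (p.2.mem_or_mem h).elim hs hr, by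
    rw [mul_smul, ← hm, ← map_smul, hsm, map_zero]⟩

/-- If `p` is the least point of the support of `M`, some quotient of `M` contains a copy of
`R ⧸ p` whose cokernel is zero at `p`: a minimal quotient that is nonzero at `p` has `p` as an
associated prime, and dividing further by a copy of `R ⧸ p` kills it at `p`. -/
lemma exists_quotient_with_generic_submodule [IsNoetherianRing R] {M : Type u} [AddCommGroup M]
    [Module R M] [Module.Finite R M] {p : PrimeSpectrum R} (hp : p ∈ Module.support R M)
    (hM : ∀ q ∈ Module.support R M, p ≤ q) :
    ∃ (N : Submodule R M) (f : (R ⧸ p.asIdeal) →ₗ[R] M ⧸ N), Function.Injective f ∧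
      p ∉ Module.support R ((M ⧸ N) ⧸ LinearMap.range f) := by
  obtain ⟨N, hN, hmax⟩ := WellFounded.has_min (wellFounded_gt (α := Submodule R M))
    {N | p ∈ Module.support R (M ⧸ N)}
    ⟨⊥, ((Submodule.quotEquivOfEqBot (⊥ : Submodule R M) rfl).support_eq ▸ hp :)⟩
  have hN' : p ∈ specClosure (ass R (M ⧸ N)) := by rwa [specClosure_ass]
  obtain ⟨q, hq, hqp⟩ := hN'
  have hqN : q ∈ Module.support R (M ⧸ N) := by
    rw [← specClosure_ass]
    exact ⟨q, hq, le_rfl⟩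
  obtain rfl : q = p := le_antisymm hqp
    (hM q (Module.support_subset_of_surjective _ N.mkQ_surjective hqN))
  have h := (isAssociatedPrime_iff_exists_injective_linearMap _ _).1 hq
  obtain ⟨f, hf⟩ := h.2
  refine ⟨N, f, hf, fun hq' ↦ ?_⟩
  let g : M →ₗ[R] (M ⧸ N) ⧸ LinearMap.range f := (LinearMap.range f).mkQ ∘ₗ N.mkQ
  have hg : Function.Surjective g :=
    (Submodule.mkQ_surjective _).comp (Submodule.mkQ_surjective _)
  refine hmax (LinearMap.ker g) ((g.quotKerEquivOfSurjective hg).support_eq ▸ hq' :) ?_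
  refine lt_of_le_of_ne (fun x hx ↦ ?_) fun h ↦ ?_
  · have : N.mkQ x = 0 := by simpa using hx
    rw [LinearMap.mem_ker, LinearMap.comp_apply, this, map_zero]
  · obtain ⟨x, hx⟩ := N.mkQ_surjective (f 1)
    have hxN : x ∈ N := by
      rw [h, LinearMap.mem_ker, LinearMap.comp_apply, hx]
      simp
    have h0 : N.mkQ x = 0 := by simpa using hxN
    have h1 : (1 : R ⧸ q.asIdeal) = 0 := hf (by rw [← hx, h0, map_zero])
    exact one_ne_zero h1

end Support

/-! ### Dévissage by truncation and by prime filtrations -/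

section Devissage

open Pretriangulated Limits DerivedCategory

variable {R : Type u} [CommRing R] [HasDerivedCategory.{w} (ModuleCat.{u} R)]

/-- A module placed in cohomological degree `i`. -/
abbrev single (i : ℤ) (M : Type u) [AddCommGroup M] [Module R M] :
    DerivedCategory (ModuleCat.{u} R) :=
  (singleFunctor (ModuleCat.{u} R) i).obj (ModuleCat.of R M)

variable {M N L : Type u} [AddCommGroup M] [AddCommGroup N] [AddCommGroup L]
  [Module R M] [Module R N] [Module R L]

/-- Functoriality of `single` for linear equivalences. -/
def singleIso (i : ℤ) (e : M ≃ₗ[R] N) : single (R := R) i M ≅ single (R := R) i N :=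
  (singleFunctor _ i).mapIso e.toModuleIso

/-- `M[-j][n] ≅ M[-i]` for `j = n + i`. -/
def singleShiftIso (i j n : ℤ) (h : n + i = j) (M : Type u) [AddCommGroup M] [Module R M] :
    (single (R := R) j M)⟦n⟧ ≅ single (R := R) i M :=
  ((singleFunctors (ModuleCat.{u} R)).shiftIso n i j h).app (ModuleCat.of R M)

lemma exists_single_triangle {f : M →ₗ[R] N} {g : N →ₗ[R] L} (hf : Function.Injective f)
    (hg : Function.Surjective g) (h : Function.Exact f g) (i : ℤ) :
    ∃ δ, Triangle.mk ((singleFunctor _ i).map (ModuleCat.ofHom f))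
      ((singleFunctor _ i).map (ModuleCat.ofHom g)) δ ∈
        distTriang (DerivedCategory (ModuleCat.{u} R)) := by
  let S : ShortComplex (ModuleCat.{u} R) := ShortComplex.mk (ModuleCat.ofHom f) (ModuleCat.ofHom g)
    (by ext x; exact h.apply_apply_eq_zero x)
  have hS : S.ShortExact :=
    { exact := (ShortComplex.ShortExact.moduleCat_exact_iff_function_exact _).2 h
      mono_f := (ModuleCat.mono_iff_injective _).2 hf
      epi_g := (ModuleCat.epi_iff_surjective _).2 hg }
  exact ⟨_, triangleOfSES_distinguished
    (hS.map_of_exact (HomologicalComplex.single (ModuleCat.{u} R) (ComplexShape.up ℤ) i))⟩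

/-- The cohomology in degree `i` of a module placed in degree `i`. -/
def homologySingleIso (i : ℤ) (M : ModuleCat.{u} R) :
    (homologyFunctor (ModuleCat.{u} R) i).obj ((singleFunctor (ModuleCat.{u} R) i).obj M) ≅ M :=
  (homologyFunctorFactors _ i).app _ ≪≫ (HomologicalComplex.homologyFunctorSingleIso _ _ i).app M

/-- The truncation triangle `τ^{≤ n} X ⟶ X ⟶ τ^{> n} X` together with its cohomology. -/
lemma exists_truncation (X : DerivedCategory (ModuleCat.{u} R)) (n : ℤ) :
    ∃ Δ ∈ distTriang (DerivedCategory (ModuleCat.{u} R)), Δ.obj₂ = X ∧ Δ.obj₁.IsLE n ∧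
      Δ.obj₃.IsGE (n + 1) ∧
      (∀ i ≤ n, Nonempty ((homologyFunctor (ModuleCat.{u} R) i).obj Δ.obj₁ ≅
        (homologyFunctor (ModuleCat.{u} R) i).obj X)) ∧
      (∀ i > n, Nonempty ((homologyFunctor (ModuleCat.{u} R) i).obj Δ.obj₃ ≅
        (homologyFunctor (ModuleCat.{u} R) i).obj X)) := by
  obtain ⟨A, B, hA, hB, f, g, h, hΔ⟩ := TStructure.t.exists_triangle X n (n + 1) rfl
  have hA' : A.IsLE n := ⟨hA⟩
  have hB' : B.IsGE (n + 1) := ⟨hB⟩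
  refine ⟨_, hΔ, rfl, hA', hB', fun i hi ↦ ?_, fun i hi ↦ ?_⟩
  · have : Mono ((homologyFunctor (ModuleCat.{u} R) i).map f) :=
      (HomologySequence.mono_homologyMap_mor₁_iff _ hΔ (i - 1) i).2
        ((isZero_of_isGE B (n + 1) (i - 1) (by lia)).eq_of_src _ _)
    have : Epi ((homologyFunctor (ModuleCat.{u} R) i).map f) :=
      (HomologySequence.epi_homologyMap_mor₁_iff _ hΔ i).2
        ((isZero_of_isGE B (n + 1) i (by lia)).eq_of_tgt _ _)
    have h : IsIso ((homologyFunctor (ModuleCat.{u} R) i).map f) := isIso_of_mono_of_epi _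
    exact ⟨@asIso _ _ _ _ _ h⟩
  · have : Mono ((homologyFunctor (ModuleCat.{u} R) i).map g) :=
      (HomologySequence.mono_homologyMap_mor₂_iff _ hΔ i).2
        ((isZero_of_isLE A n i (by lia)).eq_of_src _ _)
    have : Epi ((homologyFunctor (ModuleCat.{u} R) i).map g) :=
      (HomologySequence.epi_homologyMap_mor₂_iff _ hΔ i (i + 1)).2
        ((isZero_of_isLE A n (i + 1) (by lia)).eq_of_tgt _ _)
    have h : IsIso ((homologyFunctor (ModuleCat.{u} R) i).map g) := isIso_of_mono_of_epi _
    exact ⟨(@asIso _ _ _ _ _ h).symm⟩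

variable {P : ObjectProperty (DerivedCategory (ModuleCat.{u} R))} [P.IsTriangulatedClosed₂]
  [P.IsClosedUnderIsomorphisms] [P.ContainsZero]

/-- The case of cohomology contained in the interval `[a, a + k - 1]`, which is empty
for `k = 0`. -/
lemma of_single_homology_of_isGE_of_isLE (a : ℤ) (k : ℕ)
    (X : DerivedCategory (ModuleCat.{u} R)) [X.IsGE a] [X.IsLE (a + k - 1)]
    (h : ∀ i, P ((singleFunctor _ i).obj ((homologyFunctor _ i).obj X))) : P X := by
  induction k generalizing a X with
  | zero => exact P.prop_of_isZero (TStructure.t.isZero X (a + (0 : ℕ) - 1) a (by simp))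
  | succ k ih =>
    obtain ⟨Δ, hΔ, rfl, hLE, hGE, h₁, h₃⟩ := exists_truncation X a
    have : Δ.obj₁.IsGE a := (isGE_iff _ _).2 fun i hi ↦
      (isZero_of_isGE Δ.obj₂ a i hi).of_iso (h₁ i hi.le).some
    have : Δ.obj₃.IsLE (a + 1 + k - 1) := (isLE_iff _ _).2 fun i hi ↦
      (isZero_of_isLE Δ.obj₂ (a + (k + 1 : ℕ) - 1) i (by push_cast; lia)).of_iso (h₃ i (by lia)).some
    refine P.ext_of_isTriangulatedClosed₂ _ hΔ ?_ (ih (a + 1) Δ.obj₃ fun i ↦ ?_)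
    · obtain ⟨Y, ⟨e⟩⟩ := exists_iso_singleFunctor_obj_of_isGE_of_isLE Δ.obj₁ a
      have e' : Y ≅ (homologyFunctor _ a).obj Δ.obj₂ :=
        (homologySingleIso a Y).symm ≪≫ (homologyFunctor _ a).mapIso e.symm ≪≫ (h₁ a le_rfl).some
      exact P.prop_of_iso ((singleFunctor _ a).mapIso e'.symm ≪≫ e.symm) (h a)
    · by_cases hi : a < i
      · exact P.prop_of_iso ((singleFunctor _ i).mapIso (h₃ i hi).some.symm) (h i)
      · exact P.prop_of_isZero (Functor.map_isZero _ (isZero_of_isGE Δ.obj₃ (a + 1) i (by lia)))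

/-- A class of objects closed under extensions contains a bounded object as soon as it contains
its homology modules, each placed in its degree. -/
lemma of_single_homology {X : DerivedCategory (ModuleCat.{u} R)} (hX : Dqc R X)
    (h : ∀ i, P ((singleFunctor _ i).obj ((homologyFunctor _ i).obj X))) : P X := by
  obtain ⟨-, a, b, hab⟩ := hX
  have : X.IsGE (-b) := (isGE_iff _ _).2 fun i hi ↦ by
    have := hab (-i) (by lia)
    rw [homology, neg_neg] at this
    exact ModuleCat.isZero_of_subsingleton _
  have : X.IsLE (-b + (b - a + 1).toNat - 1) := (isLE_iff _ _).2 fun i hi ↦ by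
    have := hab (-i) (by lia)
    rw [homology, neg_neg] at this
    exact ModuleCat.isZero_of_subsingleton _
  exact of_single_homology_of_isGE_of_isLE (-b) (b - a + 1).toNat X h

/-- A class of objects closed under extensions contains a finitely generated module, placed in a
fixed degree, as soon as it contains `R ⧸ q` for each `q` in the support. -/
lemma single_of_single_quotient [IsNoetherianRing R] (i : ℤ) [hM : Module.Finite R M]
    (h : ∀ q ∈ Module.support R M, P (single i (R ⧸ q.asIdeal))) : P (single (R := R) i M) := by
  induction hM using IsNoetherianRing.induction_on_isQuotientEquivQuotientPrime R with
  | subsingleton N =>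
    exact P.prop_of_isZero (Functor.map_isZero _ (ModuleCat.isZero_of_subsingleton _))
  | quotient N p e =>
    refine P.prop_of_iso (singleIso i e.symm) (h p ?_)
    rw [e.support_eq, Module.mem_support_iff_of_finite, Ideal.annihilator_quotient]
  | exact N₁ N₂ N₃ f g hf hg hfg h₁ h₃ =>
    rw [Module.support_of_exact hfg hf hg] at h
    obtain ⟨δ, hδ⟩ := exists_single_triangle hf hg hfg i
    exact P.ext_of_isTriangulatedClosed₂ _ hδ (h₁ fun q hq ↦ h q (Or.inl hq))
      (h₃ fun q hq ↦ h q (Or.inr hq))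

end Devissage

/-! ### Koszul objects in a pre-aisle -/

section KoszulModules

variable {R : Type u} [CommRing R]

open Pointwise in
lemma support_inter_zeroLocus_subset_of_exact {M N : Type*} [AddCommGroup M] [AddCommGroup N]
    [Module R M] [Module R N] [Module.Finite R M] {x : R} {f : M →ₗ[R] N}
    (h : Function.Exact (x • LinearMap.id : M →ₗ[R] M) f) :
    Module.support R M ∩ PrimeSpectrum.zeroLocus {x} ⊆ Module.support R N := by
  rw [← Module.support_quotSMulTop]
  have hker : x • (⊤ : Submodule R M) = LinearMap.ker f := by
    rw [h.linearMap_ker_eq]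
    ext m
    simp [Submodule.mem_smul_pointwise_iff_exists]
  exact Module.support_subset_of_injective ((x • (⊤ : Submodule R M)).liftQ f hker.le)
    (LinearMap.ker_eq_bot.1 (Submodule.ker_liftQ_eq_bot _ _ _ hker.ge))

lemma support_subset_zeroLocus_of_exact {M N P : Type*} [AddCommGroup M] [AddCommGroup N]
    [AddCommGroup P] [Module R M] [Module R N] [Module R P] {x : R} {f : M →ₗ[R] N}
    {g : N →ₗ[R] P} (h₁ : Function.Exact (x • LinearMap.id : M →ₗ[R] M) f)
    (h₂ : Function.Exact f g) (h₃ : Function.Exact g (x • LinearMap.id : P →ₗ[R] P)) :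
    Module.support R N ⊆ PrimeSpectrum.zeroLocus {x} := by
  intro p hp
  rw [PrimeSpectrum.mem_zeroLocus, Set.singleton_subset_iff]
  by_contra hx
  refine Module.notMem_support_iff'.2 (fun n ↦ ⟨x * x, fun h ↦ ?_, ?_⟩) hp
  · exact (p.2.mem_or_mem h).elim hx hx
  · obtain ⟨m, hm⟩ := (h₂ (x • n)).1 (by
      rw [map_smul]
      exact h₃.apply_apply_eq_zero n)
    rw [mul_smul, ← hm, ← map_smul]
    exact h₁.apply_apply_eq_zero m

end KoszulModules

section Koszul

open Pretriangulated Limits DerivedCategory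

variable {R : Type u} [CommRing R] [HasDerivedCategory.{w} (ModuleCat.{u} R)]

lemma Dqc.finite {M : DerivedCategory (ModuleCat.{u} R)} (hM : Dqc R M) (i : ℤ) :
    Module.Finite R ((homologyFunctor (ModuleCat.{u} R) i).obj M) := by
  have := hM.1 (-i)
  rwa [homology, neg_neg] at this

/-- `φ(A)(n)` is the union of the supports of `H_n(M)` for `M ∈ A`. -/
lemma mem_phi_iff [IsNoetherianRing R] {A : ObjectProperty (DerivedCategory (ModuleCat.{u} R))}
    (hA : A ≤ Dqc R) {n : ℤ} {p : PrimeSpectrum R} :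
    p ∈ phi A n ↔ ∃ M, A M ∧ p ∈ Module.support R (homology M n) := by
  refine exists_congr fun M ↦ and_congr_right fun hM ↦ ?_
  have := (hA _ hM).1 n
  rw [specClosure_ass]

variable {D A : ObjectProperty (DerivedCategory (ModuleCat.{u} R))} [D.IsTriangulated]
  [D.IsClosedUnderIsomorphisms]

/-- The homology of the cone of multiplication by `x` on an object of a pre-aisle; the cone is
an extension of objects of the pre-aisle. -/
lemma IsPreaisle.exists_cone (hA : IsPreaisle D A) (hD : D ≤ Dqc R)
    {M : DerivedCategory (ModuleCat.{u} R)} (hM : A M) (x : R) :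
    ∃ C, A C ∧ ∀ i,
      Module.support R ((homologyFunctor (ModuleCat.{u} R) i).obj C) ⊆
        Module.support R ((homologyFunctor (ModuleCat.{u} R) i).obj M) ∪
          Module.support R ((homologyFunctor (ModuleCat.{u} R) (i + 1)).obj M) ∧
      Module.support R ((homologyFunctor (ModuleCat.{u} R) i).obj C) ⊆
        PrimeSpectrum.zeroLocus {x} ∧
      Module.support R ((homologyFunctor (ModuleCat.{u} R) i).obj M) ∩
        PrimeSpectrum.zeroLocus {x} ⊆
          Module.support R ((homologyFunctor (ModuleCat.{u} R) i).obj C) := by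
  obtain ⟨C, f, g, hΔ⟩ := distinguished_cocone_triangle (x • 𝟙 M)
  have hC : D C := D.ext_of_isTriangulatedClosed₃ _ hΔ (hA.le _ hM) (hA.le _ hM)
  refine ⟨C, hA.extension _ (rot_of_distTriang _ hΔ) hC hM (hA.suspension _ hM), fun i ↦ ?_⟩
  have hx (j : ℤ) : ((homologyFunctor (ModuleCat.{u} R) j).map (x • 𝟙 M)).hom =
      x • LinearMap.id := by
    rw [homologyFunctor_map_smul_id]
    rfl
  have h₁ : Function.Exact ((homologyFunctor (ModuleCat.{u} R) i).map (x • 𝟙 M)).hom _ :=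
    exact_homology hΔ i
  have h₂ := exact_homology_δ hΔ i (i + 1) rfl
  have h₃ : Function.Exact _ ((homologyFunctor (ModuleCat.{u} R) (i + 1)).map (x • 𝟙 M)).hom :=
    exact_δ_homology hΔ i (i + 1) rfl
  rw [hx] at h₁ h₃
  have := Dqc.finite (hD _ (hA.le _ hM)) i
  exact ⟨support_subset_union_of_exact h₂, support_subset_zeroLocus_of_exact h₁ h₂ h₃,
    support_inter_zeroLocus_subset_of_exact h₁⟩

/-- Taking the cones of multiplication by finitely many elements of `p` keeps the top degree
of the cohomology at `p`, by Nakayama's lemma, and cuts the supports down to the zero locus of these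
elements. -/
lemma IsPreaisle.exists_support_subset_zeroLocus (hA : IsPreaisle D A) (hD : D ≤ Dqc R)
    {M : DerivedCategory (ModuleCat.{u} R)} (hM : A M) {p : PrimeSpectrum R} {i : ℤ}
    (hp : p ∈ Module.support R ((homologyFunctor (ModuleCat.{u} R) i).obj M))
    (hp' : ∀ j > i, p ∉ Module.support R ((homologyFunctor (ModuleCat.{u} R) j).obj M))
    (s : Finset R) (hs : ↑s ⊆ (p.asIdeal : Set R)) :
    ∃ N, A N ∧ p ∈ Module.support R ((homologyFunctor (ModuleCat.{u} R) i).obj N) ∧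
      (∀ j > i, p ∉ Module.support R ((homologyFunctor (ModuleCat.{u} R) j).obj N)) ∧
      ∀ j, Module.support R ((homologyFunctor (ModuleCat.{u} R) j).obj N) ⊆
        PrimeSpectrum.zeroLocus s := by
  classical
  induction s using Finset.induction_on with
  | empty => exact ⟨M, hM, hp, hp', fun j ↦ by simp⟩
  | insert x s _ ih =>
    rw [Finset.coe_insert, Set.insert_subset_iff] at hs
    obtain ⟨N, hN, h₁, h₂, h₃⟩ := ih hs.2
    obtain ⟨C, hC, h⟩ := hA.exists_cone hD hN x
    refine ⟨C, hC, (h i).2.2 ⟨h₁, by simpa using hs.1⟩, fun j hj hpj ↦ ?_, fun j q hq ↦ ?_⟩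
    · exact ((h j).1 hpj).elim (h₂ j hj) (h₂ (j + 1) (by lia))
    · rw [Finset.coe_insert, Set.insert_eq, PrimeSpectrum.zeroLocus_union]
      exact ⟨(h j).2.1 hq, ((h j).1 hq).elim (fun h ↦ h₃ j h) (fun h ↦ h₃ (j + 1) h)⟩

/-- If `p ∈ φ(A)(n)` then the pre-aisle `A` contains, for each `i ≤ -n`, an object supported on
the closure of `p` whose top cohomology module at `p` is in degree `i`: shift a Koszul complex of
generators of `p` with coefficients in an object of `A`. -/
lemma IsPreaisle.exists_of_mem_phi [IsNoetherianRing R] (hA : IsPreaisle D A) (hD : D ≤ Dqc R)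
    {p : PrimeSpectrum R} {n i : ℤ} (hp : p ∈ phi A n) (hi : i ≤ -n) :
    ∃ N, A N ∧ p ∈ Module.support R ((homologyFunctor (ModuleCat.{u} R) i).obj N) ∧
      (∀ j > i, p ∉ Module.support R ((homologyFunctor (ModuleCat.{u} R) j).obj N)) ∧
      ∀ j, ∀ q ∈ Module.support R ((homologyFunctor (ModuleCat.{u} R) j).obj N), p ≤ q := by
  obtain ⟨M, hM, hpM⟩ := (mem_phi_iff (hA.le.trans hD)).1 hp
  obtain ⟨-, b, b', hb⟩ := hD _ (hA.le _ hM)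
  -- The top degree `a ≥ -n` of the cohomology of `M` at `p`.
  obtain ⟨a, ha, ha'⟩ := Int.exists_greatest_of_bdd
    (P := fun j ↦ p ∈ Module.support R ((homologyFunctor (ModuleCat.{u} R) j).obj M))
    ⟨-b, fun j hj ↦ by
      by_contra hlt
      have := hb (-j) (Or.inl (by lia))
      rw [homology, neg_neg] at this
      rw [Module.support_eq_empty] at hj
      exact hj⟩ ⟨-n, hpM⟩
  obtain ⟨s, hs⟩ := IsNoetherian.noetherian p.asIdeal
  obtain ⟨N, hN, h₁, h₂, h₃⟩ := hA.exists_support_subset_zeroLocus hD hM ha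
    (fun j hj h ↦ absurd (ha' j h) (by lia)) s (hs ▸ Ideal.subset_span)
  have hai := hi.trans (ha' _ hpM)
  have e (j : ℤ) := (homologyShiftIso N ((a - i).toNat : ℤ) j (a - i + j) (by lia)).toLinearEquiv
  refine ⟨N⟦((a - i).toNat : ℤ)⟧, hA.shift_nat _ hN, ?_, fun j hj ↦ ?_, fun j q hq ↦ ?_⟩
  · rwa [(e i).support_eq, sub_add_cancel]
  · rw [(e j).support_eq]
    exact h₂ _ (by lia)
  · rw [(e j).support_eq] at hq
    have hq := h₃ _ hq
    rw [← PrimeSpectrum.zeroLocus_span] at hq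
    change p.asIdeal ≤ q.asIdeal
    rw [← hs]
    exact hq

end Koszul

/-! ### Vanishing of morphisms to the right orthogonal -/

section Key

open Pretriangulated Limits DerivedCategory

variable {R : Type u} [CommRing R] [HasDerivedCategory.{w} (ModuleCat.{u} R)]

lemma smul_id_single (j : ℤ) (L : Type u) [AddCommGroup L] [Module R L] (r : R) :
    (singleFunctor (ModuleCat.{u} R) j).map (ModuleCat.ofHom (r • LinearMap.id : L →ₗ[R] L)) =
      r • 𝟙 (single (R := R) j L) := by
  rw [← CategoryTheory.Functor.map_id, ← Functor.map_smul]
  rfl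

lemma homTorsion_single_of_notMem_support (Y : DerivedCategory (ModuleCat.{u} R))
    {p : PrimeSpectrum R} (j : ℤ) (L : Type u) [AddCommGroup L] [Module R L] [Module.Finite R L]
    (hp : p ∉ Module.support R L) :
    homTorsion p.asIdeal.primeCompl Y (single (R := R) j L) := by
  obtain ⟨r, hr, h⟩ := exists_smul_eq_zero_of_notMem_support hp
  refine homTorsion_of_smul_id Y hr ?_
  rw [← smul_id_single, show (r • LinearMap.id : L →ₗ[R] L) = 0 from LinearMap.ext h]
  exact Functor.map_zero _ _ _

lemma Dqc_of_homology {M N : DerivedCategory (ModuleCat.{u} R)} (hM : Dqc R M)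
    (h : ∀ i, Nonempty ((homologyFunctor (ModuleCat.{u} R) i).obj N ≅
      (homologyFunctor (ModuleCat.{u} R) i).obj M) ∨
        IsZero ((homologyFunctor (ModuleCat.{u} R) i).obj N)) : Dqc R N := by
  obtain ⟨hfin, a, b, hab⟩ := hM
  refine ⟨fun n ↦ ?_, a, b, fun n hn ↦ ?_⟩
  · obtain ⟨⟨e⟩⟩ | h := h (-n)
    · exact finite_congr e.symm (hfin n)
    · have := ModuleCat.subsingleton_of_isZero h
      infer_instance
  · obtain ⟨⟨e⟩⟩ | h := h (-n)
    · exact subsingleton_congr e.symm (hab n hn)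
    · exact ModuleCat.subsingleton_of_isZero h

/-- If `p` is the generic point of the support of a bounded complex `M`, the cohomology of `M`
at `p` vanishes in degrees `> i`, and `Hom(M, Y)_p = 0`, then `Hom(H^i(M)[-i], Y)_p = 0`, provided
that modules with support in the closure of `p` have no morphism to `Y` from degrees `< i`. -/
lemma homTorsion_single_homology [IsNoetherianRing R] {Y M : DerivedCategory (ModuleCat.{u} R)}
    {p : PrimeSpectrum R} {i : ℤ} (hM : Dqc R M)
    (htop : ∀ j > i, p ∉ Module.support R ((homologyFunctor (ModuleCat.{u} R) j).obj M))
    (hsupp : ∀ j, ∀ q ∈ Module.support R ((homologyFunctor (ModuleCat.{u} R) j).obj M), p ≤ q)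
    (hlow : ∀ j < i, ∀ (L : Type u) [AddCommGroup L] [Module R L] [Module.Finite R L],
      (∀ q ∈ Module.support R L, p ≤ q) →
        homTorsion p.asIdeal.primeCompl Y (single (R := R) j L))
    (hMY : homTorsion p.asIdeal.primeCompl Y M) :
    homTorsion p.asIdeal.primeCompl Y
      (single (R := R) i ((homologyFunctor (ModuleCat.{u} R) i).obj M)) := by
  obtain ⟨Δ, hΔ, rfl, hLE, hGE, h₁, h₃⟩ := exists_truncation M i
  have hA : Dqc R Δ.obj₁ := Dqc_of_homology hM fun j ↦ by
    by_cases hj : j ≤ i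
    · exact Or.inl (h₁ j hj)
    · exact Or.inr (isZero_of_isLE _ i j (by lia))
  have hB : Dqc R Δ.obj₃ := Dqc_of_homology hM fun j ↦ by
    by_cases hj : i < j
    · exact Or.inl (h₃ j hj)
    · exact Or.inr (isZero_of_isGE _ (i + 1) j (by lia))
  -- The cohomology of `τ^{> i} M` vanishes at `p`, so `τ^{≤ i} M` inherits `Hom(-, Y)_p = 0`.
  have hAY : homTorsion p.asIdeal.primeCompl Y Δ.obj₁ := by
    refine ObjectProperty.ext_of_isTriangulatedClosed₂ _ _ (inv_rot_of_distTriang _ hΔ) ?_ hMY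
    refine of_single_homology ((Dqc R).le_shift (-1) _ hB) fun j ↦ ?_
    have e := homologyShiftIso Δ.obj₃ (-1) j (j - 1) (by ring)
    refine ObjectProperty.prop_of_iso _ ((singleFunctor _ j).mapIso e.symm) ?_
    have := hB.finite (j - 1)
    refine homTorsion_single_of_notMem_support Y j _ ?_
    by_cases hj : i < j - 1
    · rw [(h₃ _ hj).some.toLinearEquiv.support_eq]
      exact htop _ hj
    · have := ModuleCat.subsingleton_of_isZero (isZero_of_isGE Δ.obj₃ (i + 1) (j - 1) (by lia))
      rw [Module.support_eq_empty]
      exact Set.notMem_empty _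
  obtain ⟨Δ', hΔ', hX, hLE', hGE', h₁', h₃'⟩ := exists_truncation Δ.obj₁ (i - 1)
  have hA' : Dqc R Δ'.obj₁ := Dqc_of_homology hA fun j ↦ by
    by_cases hj : j ≤ i - 1
    · exact Or.inl (h₁' j hj)
    · exact Or.inr (isZero_of_isLE _ (i - 1) j (by lia))
  -- The cohomology of `(τ^{< i} M)[1]` is in degrees `< i - 1`, where `hlow` applies.
  have hC : homTorsion p.asIdeal.primeCompl Y Δ'.obj₃ := by
    refine ObjectProperty.ext_of_isTriangulatedClosed₂ _ _ (rot_of_distTriang _ hΔ')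
      (by rw [← hX] at hAY; exact hAY) ?_
    refine of_single_homology ((Dqc R).le_shift 1 _ hA') fun j ↦ ?_
    have e := homologyShiftIso Δ'.obj₁ 1 j (j + 1) (by ring)
    refine ObjectProperty.prop_of_iso _ ((singleFunctor _ j).mapIso e.symm) ?_
    have := hA'.finite (j + 1)
    by_cases hj : j + 1 ≤ i - 1
    · refine hlow j (by lia) _ fun q hq ↦ hsupp (j + 1) q ?_
      rwa [((h₁' _ hj).some ≪≫ (h₁ _ (by lia)).some).toLinearEquiv.support_eq] at hq
    · exact ObjectProperty.prop_of_isZero _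
        (Functor.map_isZero _ (isZero_of_isLE Δ'.obj₁ (i - 1) (j + 1) (by lia)))
  have : Δ'.obj₃.IsGE i := by simpa using hGE'
  have : Δ'.obj₃.IsLE i := (isLE_iff _ _).2 fun j hj ↦
    (isZero_of_isLE Δ.obj₁ i j hj).of_iso (h₃' j (by lia)).some
  obtain ⟨L, ⟨e⟩⟩ := exists_iso_singleFunctor_obj_of_isGE_of_isLE Δ'.obj₃ i
  have e' : L ≅ (homologyFunctor _ i).obj Δ.obj₂ :=
    (homologySingleIso i L).symm ≪≫ (homologyFunctor _ i).mapIso e.symm ≪≫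
      (h₃' i (by lia)).some ≪≫ (h₁ i le_rfl).some
  exact ObjectProperty.prop_of_iso _ (e ≪≫ (singleFunctor _ i).mapIso e') hC

/-- If `p` is the generic point of the support of `H` and `Hom(H[-i], Y)_p = 0`, then
`Hom((R ⧸ p)[-i], Y)_p = 0`. The minimal quotient of `H` that is nonzero at `p` inherits the
hypothesis because the kernel sits in degree `i - 1` after a shift, and it differs from `R ⧸ p` by
a module that vanishes at `p`. -/
lemma homTorsion_single_quotient [IsNoetherianRing R] {Y : DerivedCategory (ModuleCat.{u} R)}
    {p : PrimeSpectrum R} {i : ℤ} {H : Type u} [AddCommGroup H] [Module R H] [Module.Finite R H]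
    (hp : p ∈ Module.support R H) (hsupp : ∀ q ∈ Module.support R H, p ≤ q)
    (hlow : ∀ j < i, ∀ (L : Type u) [AddCommGroup L] [Module R L] [Module.Finite R L],
      (∀ q ∈ Module.support R L, p ≤ q) →
        homTorsion p.asIdeal.primeCompl Y (single (R := R) j L))
    (hHY : homTorsion p.asIdeal.primeCompl Y (single (R := R) i H)) :
    homTorsion p.asIdeal.primeCompl Y (single (R := R) i (R ⧸ p.asIdeal)) := by
  obtain ⟨N, f, hf, hpf⟩ := exists_quotient_with_generic_submodule hp hsupp
  obtain ⟨δ, hδ⟩ := exists_single_triangle N.injective_subtype N.mkQ_surjective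
    (LinearMap.exact_subtype_mkQ N) i
  have hQ : homTorsion p.asIdeal.primeCompl Y (single (R := R) i (H ⧸ N)) := by
    refine ObjectProperty.ext_of_isTriangulatedClosed₂ _ _ (rot_of_distTriang _ hδ) hHY
      (ObjectProperty.prop_of_iso _ (singleShiftIso (i - 1) i 1 (by ring) N).symm
        (hlow (i - 1) (by lia) N fun q hq ↦ hsupp q ?_))
    exact Module.support_subset_of_injective _ N.injective_subtype hq
  obtain ⟨δ', hδ'⟩ := exists_single_triangle hf (LinearMap.range f).mkQ_surjective
    (LinearMap.exact_map_mkQ_range f) i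
  exact ObjectProperty.ext_of_isTriangulatedClosed₂ _ _ (inv_rot_of_distTriang _ hδ')
    (ObjectProperty.prop_of_iso _ (singleShiftIso (i + 1) i (-1) (by ring) _).symm
      (homTorsion_single_of_notMem_support Y (i + 1) _ hpf)) hQ

/-- `Hom((R ⧸ p)[-i], Y)` has no torsion over `R ⧸ p` when `Hom((R ⧸ q)[-i], Y) = 0` for all
primes `q` strictly containing `p`. -/
lemma eq_zero_of_homTorsion_single_quotient [IsNoetherianRing R]
    {Y : DerivedCategory (ModuleCat.{u} R)} {p : PrimeSpectrum R} {i : ℤ}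
    (hq : ∀ q, p < q → ∀ f : single i (R ⧸ q.asIdeal) ⟶ Y, f = 0)
    (h : homTorsion p.asIdeal.primeCompl Y (single (R := R) i (R ⧸ p.asIdeal)))
    (f : single (R := R) i (R ⧸ p.asIdeal) ⟶ Y) : f = 0 := by
  obtain ⟨r, hr, hf⟩ := h f
  let μ : (R ⧸ p.asIdeal) →ₗ[R] (R ⧸ p.asIdeal) := r • LinearMap.id
  have hμ : Function.Injective μ := by
    rw [injective_iff_map_eq_zero]
    intro x hx
    obtain ⟨x, rfl⟩ := Ideal.Quotient.mk_surjective x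
    have : Ideal.Quotient.mk p.asIdeal (r * x) = 0 := hx
    rw [Ideal.Quotient.eq_zero_iff_mem] at this ⊢
    exact (p.2.mem_or_mem this).resolve_left hr
  obtain ⟨δ, hδ⟩ := exists_single_triangle hμ (LinearMap.range μ).mkQ_surjective
    (LinearMap.exact_map_mkQ_range μ) i
  have hμf : (singleFunctor _ i).map (ModuleCat.ofHom μ) ≫ f = 0 := by
    rw [smul_id_single, Linear.smul_comp, Category.id_comp, hf]
  obtain ⟨g, hg⟩ := Triangle.yoneda_exact₂ _ hδ f hμf
  have hcoker : homTorsion (⊥ : Submonoid R) Y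
      (single (R := R) i ((R ⧸ p.asIdeal) ⧸ LinearMap.range μ)) := by
    refine single_of_single_quotient i fun q hq' ↦ (homTorsion_bot_iff _ _).2 (hq q ?_)
    refine lt_of_le_of_ne ?_ ?_
    · have := Module.support_subset_of_surjective _ (LinearMap.range μ).mkQ_surjective hq'
      rwa [Module.mem_support_iff_of_finite, Ideal.annihilator_quotient] at this
    · rintro rfl
      refine Module.notMem_support_iff'.2 (fun m ↦ ⟨r, hr, ?_⟩) hq'
      obtain ⟨m, rfl⟩ := (LinearMap.range μ).mkQ_surjective m
      rw [← map_smul, Submodule.mkQ_apply, Submodule.Quotient.mk_eq_zero]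
      exact ⟨m, rfl⟩
  rw [hg, (homTorsion_bot_iff _ _).1 hcoker g]
  exact comp_zero

variable {D A A' : ObjectProperty (DerivedCategory (ModuleCat.{u} R))}

/-- An object `Y` right orthogonal to the pre-aisle `A` receives no nonzero morphism from
`(R ⧸ p)[-i]` for `p ∈ φ(A)(n)` and `i ≤ -n`. -/
lemma IsPreaisle.eq_zero_of_mem_phi [IsNoetherianRing R] [D.IsTriangulated]
    [D.IsClosedUnderIsomorphisms] (hA : IsPreaisle D A) (hD : D ≤ Dqc R)
    {Y : DerivedCategory (ModuleCat.{u} R)} (hY : Dqc R Y) (hAY : ∀ B, A B → ∀ f : B ⟶ Y, f = 0)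
    {n i : ℤ} (hi : i ≤ -n) {p : PrimeSpectrum R} (hp : p ∈ phi A n)
    (f : single (R := R) i (R ⧸ p.asIdeal) ⟶ Y) : f = 0 := by
  obtain ⟨-, a, b, hab⟩ := hY
  have hGE : Y.IsGE (-b) := (isGE_iff _ _).2 fun i hi ↦ by
    have := hab (-i) (by lia)
    rw [homology, neg_neg] at this
    exact ModuleCat.isZero_of_subsingleton _
  have hup : ∀ {p q : PrimeSpectrum R}, p ∈ phi A n → p ≤ q → q ∈ phi A n := by
    rintro p q ⟨M, hM, q', hq', hle⟩ hpq
    exact ⟨M, hM, q', hq', hle.trans hpq⟩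
  -- Induct on the degree, starting below the cohomology of `Y`.
  obtain ⟨k, hk⟩ : ∃ k : ℕ, i < -b + k := ⟨(i + b + 1).toNat, by lia⟩
  induction k generalizing i p with
  | zero =>
    exact TStructure.t.zero f i (-b) (by simpa using hk)
  | succ k ih =>
    -- Noetherian induction on `p`, starting from the maximal ideals.
    have : WellFoundedGT (PrimeSpectrum R) :=
      ⟨InvImage.wf PrimeSpectrum.asIdeal (wellFounded_gt (α := Ideal R))⟩
    induction p using WellFoundedGT.induction with
    | ind p ihp =>
      have hlow : ∀ j < i, ∀ (L : Type u) [AddCommGroup L] [Module R L] [Module.Finite R L],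
          (∀ q ∈ Module.support R L, p ≤ q) →
            homTorsion p.asIdeal.primeCompl Y (single (R := R) j L) := by
        intro j hj L _ _ _ hL
        refine homTorsion_mono bot_le Y _ (single_of_single_quotient j fun q hq ↦ ?_)
        exact (homTorsion_bot_iff _ _).2 fun g ↦
          ih (by lia) (hup hp (hL q hq)) g (by push_cast at hk; lia)
      obtain ⟨M, hM, h₁, h₂, h₃⟩ := hA.exists_of_mem_phi hD hp hi
      have hMD := hD _ (hA.le _ hM)
      have := hMD.finite i
      refine eq_zero_of_homTorsion_single_quotient (fun q hq g ↦ ?_)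
        (homTorsion_single_quotient h₁ (h₃ i) hlow (homTorsion_single_homology hMD h₂ h₃ hlow
          fun g ↦ ⟨1, one_mem _, by rw [hAY M hM g, smul_zero]⟩)) f
      exact ihp q hq (hup hp hq.le) g

lemma IsAisle.le_of_phi_subset [IsNoetherianRing R] [D.IsTriangulated]
    [D.IsClosedUnderIsomorphisms] (hD : D ≤ Dqc R) (hA : IsAisle D A)
    (hA' : IsAisle D A') (h : ∀ n, phi A n ⊆ phi A' n) : A ≤ A' := by
  intro X hX
  refine hA'.mem_of_forall_eq_zero (hA.le _ hX) fun Y hY hYA' ↦ ?_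
  have hXD := hD _ (hA.le _ hX)
  rw [← homTorsion_bot_iff (R := R)]
  refine of_single_homology hXD fun i ↦ ?_
  have := hXD.finite i
  refine single_of_single_quotient i fun q hq ↦ (homTorsion_bot_iff _ _).2 ?_
  refine hA'.toIsPreaisle.eq_zero_of_mem_phi hD (hD _ hY) hYA' (n := -i) (by simp) (h _ ?_)
  refine (mem_phi_iff (hA.le.trans hD)).2 ⟨X, hX, ?_⟩
  rwa [homology, neg_neg]

lemma phi_mono (h : A ≤ A') (n : ℤ) : phi A n ⊆ phi A' n := fun _ ⟨M, hM, hp⟩ ↦ ⟨M, h _ hM, hp⟩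

lemma IsPreaisle.phi_mem_increasingFunctions [IsNoetherianRing R] (hD : D ≤ Dqc R)
    (hA : IsPreaisle D A) : phi A ∈ increasingFunctions R := by
  refine ⟨fun n ↦ Set.Subset.antisymm (fun p hp ↦ ⟨p, hp, le_rfl⟩) ?_, fun n p hp ↦ ?_⟩
  · rintro p ⟨q, ⟨M, hM, q', hq', hle⟩, hqp⟩
    exact ⟨M, hM, q', hq', hle.trans hqp⟩
  · obtain ⟨M, hM, hp⟩ := (mem_phi_iff (hA.le.trans hD)).1 hp
    refine (mem_phi_iff (hA.le.trans hD)).2 ⟨M⟦(1 : ℤ)⟧, hA.suspension _ hM, ?_⟩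
    rwa [(homologyShiftIso M 1 (-(n + 1)) (-n) (by ring)).toLinearEquiv.support_eq]

end Key

end Aisles
end

theorem theorem4p3 (R : Type u) [CommRing R] [IsNoetherianRing R]
    [HasDerivedCategory.{w} (ModuleCat.{u} R)]
    (D : ObjectProperty (DerivedCategory (ModuleCat.{u} R)))
    (hD : D = Aisles.Dqc R ∨ D = Aisles.Dparf R) :
    (∀ A A' : ObjectProperty (DerivedCategory (ModuleCat.{u} R)),
      Aisles.IsAisle D A → Aisles.IsAisle D A' →
        (A ≤ A' ↔ ∀ n : ℤ, Aisles.phi A n ⊆ Aisles.phi A' n)) ∧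
    Set.MapsTo Aisles.phi {A | Aisles.IsAisle D A} (Aisles.increasingFunctions R) ∧
    Set.InjOn Aisles.phi {A | Aisles.IsAisle D A} := by
  obtain ⟨hle, _, _⟩ : D ≤ Aisles.Dqc R ∧ D.IsTriangulated ∧ D.IsClosedUnderIsomorphisms := by
    obtain rfl | rfl := hD
    · exact ⟨le_rfl, inferInstance, inferInstance⟩
    · exact ⟨Aisles.Dparf_le_Dqc, inferInstance, inferInstance⟩
  refine ⟨fun A A' hA hA' ↦ ⟨Aisles.phi_mono, hA.le_of_phi_subset hle hA'⟩,
    fun A hA ↦ hA.toIsPreaisle.phi_mem_increasingFunctions hle, fun A hA A' hA' h ↦ ?_⟩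
  exact le_antisymm (hA.le_of_phi_subset hle hA' fun n ↦ (congrFun h n).le)
    (hA'.le_of_phi_subset hle hA fun n ↦ (congrFun h n).ge)
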